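/- Let $M$ be a smooth manifold with a Riemannian metric $g$ and a smooth $(1,1)$-tensor field $P$ such that $P^2=\mathrm{id}$, $g(Px,Py)=g(x,y)$ and $\operatorname{tr}P=0$. Let $\nabla$ be the Levi-Civita connection of $g$ and put $F(x,y,z)=g((\nabla_xP)y,z)$. Suppose that $(M,P,g)$ is a Riemannian $\mathcal W_3$-manifold, i.e. $F(x,y,z)+F(y,z,x)+F(z,x,y)=0$ for all $x,y,z$. Let $\nabla'$ be the canonical connection of $(M,P,g)$, i.e. the linear connection with $\nabla'g=0$ and $\nabla'P=0$ whose torsion $T(x,y,z)=g(\nabla'_xy-\nabla'_yx-[x,y],z)$ satisfies $$T(x,y,z)+T(y,z,x)+T(Px,y,Pz)+T(y,Pz,Px)=0$$ for all $x,y,z$. For a linear connection $D$ with curvature $R^D(x,y)z=D_xD_yz-D_yD_xz-D_{[x,y]}z$, the scalar curvature at a point is $\sum_{i,j}g(R^D(e_i,e_j)e_j,e_i)$, where $(e_i)$ is an orthonormal basis of the tangent space. Let $\tau'$ and $\tau$ be the scalar curvatures of $\nabla'$ and $\nabla$, and let $\|\nabla P\|^2=\sum_{i,k}g\big((\nabla_{e_i}P)e_k,(\nabla_{e_i}P)e_k\big)$.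 Then at every point of $M$ $$\tau'=\tau+\frac18\,\|\nabla P\|^2 .$$ -/

import Mathlib

open Bundle
open scoped Manifold ContDiff

noncomputable section

namespace RiemannianAlmostProduct

variable {E : Type*} [NormedAddCommGroup E] [NormedSpace ℝ E] [FiniteDimensional ℝ E]
  {H : Type*} [TopologicalSpace H] {I : ModelWithCorners ℝ E H}
  {M : Type*} [TopologicalSpace M] [ChartedSpace H M] [IsManifold I ∞ M]

/-- For a linear connection `nab` and a field `P` of endomorphisms of the tangent spaces, the value
`(∇_u P) v = ∇_u (P V) - P (∇_u V)`, where the vector field `V` extends the tangent vector `v` at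
`x` and is smooth near `x`. The value does not depend on the extension. -/
def covDerivEnd (nab : CovariantDerivative I E (TangentSpace I : M → Type _))
    (P : Π x : M, TangentSpace I x →L[ℝ] TangentSpace I x) (x : M)
    (u v : TangentSpace I x) : TangentSpace I x :=
  nab (fun p => P p (FiberBundle.extend E v p)) x u - P x (nab (FiberBundle.extend E v) x u)

/-- For vector fields `X`, `Y`, `Z`, the value at `x` of
`∇_X ∇_Y Z - ∇_Y ∇_X Z - ∇_[X,Y] Z`. (In Mathlib, `nab Z x (X x)` is the value of `∇_X Z` at `x`.) -/
def curvatureField (nab : CovariantDerivative I E (TangentSpace I : M → Type _))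
    (X Y Z : Π x : M, TangentSpace I x) (x : M) : TangentSpace I x :=
  nab (fun p => nab Z p (Y p)) x (X x) - nab (fun p => nab Z p (X p)) x (Y x)
    - nab Z x (VectorField.mlieBracket I X Y x)

/-- The curvature tensor `R(u,v)w` of a linear connection at tangent vectors `u`, `v`, `w` at `x`,
computed with vector fields that extend `u`, `v`, `w` and are smooth near `x`. For a smooth
connection the value does not depend on the extensions. -/
def curvature (nab : CovariantDerivative I E (TangentSpace I : M → Type _)) (x : M)
    (u v w : TangentSpace I x) : TangentSpace I x :=
  curvatureField nab (FiberBundle.extend E u) (FiberBundle.extend E v) (FiberBundle.extend E w) x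

/-- A linear connection in the usual sense: it maps smooth vector fields to smooth ones. -/
abbrev IsSmoothConnection (nab : CovariantDerivative I E (TangentSpace I : M → Type _)) : Prop :=
  CovariantDerivative.ContMDiffCovariantDerivative nab ∞

section Metric

variable [RiemannianBundle (fun x : M => TangentSpace I x)]

variable (I M) in
/-- A Riemannian almost product structure with vanishing trace: a smooth field `P` of endomorphisms
of the tangent spaces with `P² = id`, `g(Pu, Pv) = g(u, v)` and `tr P = 0`. -/
structure AlmostProductStructure where
  /-- The endomorphism field. -/
  P : Π x : M, TangentSpace I x →L[ℝ] TangentSpace I x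
  smooth : ContMDiff I (I.prod 𝓘(ℝ, E →L[ℝ] E)) ∞
    (fun x => (⟨x, P x⟩ :
      TotalSpace (E →L[ℝ] E) (fun x : M => TangentSpace I x →L[ℝ] TangentSpace I x)))
  involutive : ∀ (x : M) (v : TangentSpace I x), P x (P x v) = v
  isometric : ∀ (x : M) (u v : TangentSpace I x), inner ℝ (P x u) (P x v) = inner ℝ u v
  trace_eq_zero : ∀ x : M, LinearMap.trace ℝ (TangentSpace I x) (P x : _ →ₗ[ℝ] _) = 0

/-- The tensor `F(u,v,w) = g((∇_u P) v, w)`. -/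
def tensorF (nab : CovariantDerivative I E (TangentSpace I : M → Type _))
    (S : AlmostProductStructure I M) (x : M) (u v w : TangentSpace I x) : ℝ :=
  inner ℝ (covDerivEnd nab S.P x u v) w

/-- The class `W₃`: the cyclic sum of `F` vanishes (`nab` is meant to be the Levi-Civita
connection). -/
def IsW3 (nab : CovariantDerivative I E (TangentSpace I : M → Type _))
    (S : AlmostProductStructure I M) : Prop :=
  ∀ (x : M) (u v w : TangentSpace I x),
    tensorF nab S x u v w + tensorF nab S x v w u + tensorF nab S x w u v = 0

/-- The square norm of `∇P` at `x`, computed in an orthonormal basis of the tangent space. -/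
def normSqNablaP (nab : CovariantDerivative I E (TangentSpace I : M → Type _))
    (S : AlmostProductStructure I M) (x : M) : ℝ :=
  haveI : FiniteDimensional ℝ (TangentSpace I x) := inferInstanceAs (FiniteDimensional ℝ E)
  let e := stdOrthonormalBasis ℝ (TangentSpace I x)
  ∑ i, ∑ k, inner ℝ (covDerivEnd nab S.P x (e i) (e k)) (covDerivEnd nab S.P x (e i) (e k))

/-- The Ricci tensor `ρ(v,w) = ∑ᵢ g(R(eᵢ,v)w, eᵢ)` of a linear connection, with `(eᵢ)` an
orthonormal basis of the tangent space. -/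
def ricci (nab : CovariantDerivative I E (TangentSpace I : M → Type _)) (x : M)
    (v w : TangentSpace I x) : ℝ :=
  haveI : FiniteDimensional ℝ (TangentSpace I x) := inferInstanceAs (FiniteDimensional ℝ E)
  let e := stdOrthonormalBasis ℝ (TangentSpace I x)
  ∑ i, inner ℝ (curvature nab x (e i) v w) (e i)

/-- The scalar curvature of a linear connection: the metric trace of its Ricci tensor. -/
def scalarCurvature (nab : CovariantDerivative I E (TangentSpace I : M → Type _)) (x : M) : ℝ :=
  haveI : FiniteDimensional ℝ (TangentSpace I x) := inferInstanceAs (FiniteDimensional ℝ E)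
  let e := stdOrthonormalBasis ℝ (TangentSpace I x)
  ∑ j, ricci nab x (e j) (e j)

/-- `∇g = 0`: for a tangent vector `u` at `x` and vector fields `Y`, `Z` differentiable at `x`,
`u (g(Y,Z)) = g(∇_u Y, Z) + g(Y, ∇_u Z)`. -/
def IsMetric (nab : CovariantDerivative I E (TangentSpace I : M → Type _)) : Prop :=
  ∀ (Y Z : Π x : M, TangentSpace I x) (x : M) (u : TangentSpace I x),
    MDifferentiableAt I I.tangent (fun p => (⟨p, Y p⟩ : TangentBundle I M)) x →
    MDifferentiableAt I I.tangent (fun p => (⟨p, Z p⟩ : TangentBundle I M)) x →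
    mvfderiv I (fun p => inner ℝ (Y p) (Z p)) x u
      = inner ℝ (nab Y x u) (Z x) + inner ℝ (Y x) (nab Z x u)

/-- The Levi-Civita connection: `∇g = 0` and zero torsion. -/
structure IsLeviCivita (nab : CovariantDerivative I E (TangentSpace I : M → Type _)) : Prop where
  smooth : IsSmoothConnection nab
  metric : IsMetric nab
  torsion_eq_zero : nab.torsion = 0

/-- A natural connection: a linear connection with `∇'g = 0` and `∇'P = 0`. -/
structure IsNatural (nab' : CovariantDerivative I E (TangentSpace I : M → Type _))
    (S : AlmostProductStructure I M) : Prop where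
  smooth : IsSmoothConnection nab'
  metric : IsMetric nab'
  parallel : ∀ (x : M) (u v : TangentSpace I x), covDerivEnd nab' S.P x u v = 0

/-- The torsion tensor as a tensor of type (0,3): `T(u,v,w) = g(T(u,v), w)`. -/
def torsion03 (nab' : CovariantDerivative I E (TangentSpace I : M → Type _)) (x : M)
    (u v w : TangentSpace I x) : ℝ :=
  inner ℝ (nab'.torsion x u v) w

/-- A canonical connection: a natural connection whose torsion tensor satisfies
`T(u,v,w) + T(v,w,u) + T(Pu,v,Pw) + T(v,Pw,Pu) = 0`. -/
structure IsCanonical (nab' : CovariantDerivative I E (TangentSpace I : M → Type _))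
    (S : AlmostProductStructure I M) : Prop extends IsNatural nab' S where
  torsion_eq : ∀ (x : M) (u v w : TangentSpace I x),
    torsion03 nab' x u v w + torsion03 nab' x v w u
      + torsion03 nab' x (S.P x u) v (S.P x w) + torsion03 nab' x v (S.P x w) (S.P x u) = 0

end Metric

end RiemannianAlmostProduct

end

/-! Put `Q = ∇' - ∇`. Since `∇` is torsion-free, `R' - R` is the antisymmetrised derivative `∇'Q`
plus terms quadratic in `Q` (`curvature_eq_add`). Differentiating `Q` by `∇'` rather than `∇` is the
point: `∇'` preserves `g` and `P`, so `∇'Q` inherits the identities of `Q` that are built from them.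

The rest is linear algebra at one point (`IsCanonicalDifference`). In an orthonormal eigenbasis of
`P`, put `q_ijk = g(Q(b_i, b_j), b_k)`, which is skew in `j, k`. The `W₃` condition and the torsion
condition become linear relations between `q_ijk`, `q_jki`, `q_kij`; they leave no freedom if the
three eigenvalues agree, and one parameter otherwise (`eigen_relations`).

This has two consequences. The bilinear maps `Q` and `∇'_u Q` are trace-free (`symm_part`,
`derivDifference_symm_part`), so the scalar curvatures differ by `∑ g(Q(e_i, e_j), Q(e_j, e_i))`
(`sum_curvature_difference`). And `(∇_u P)v = P Q(u, v) - Q(u, Pv)` identifies this sum with `‖∇P‖²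
/ 8` (`sum_inner_swap`); the equality holds after a cyclic sum over each triple of indices, not term
by term. -/

section LinearAlgebra

/-! ### Pointwise algebra of the difference tensor. -/

variable {V : Type*} [NormedAddCommGroup V] [InnerProductSpace ℝ V]

/-- The trace of a bilinear map over an orthonormal basis does not depend on the basis. -/
lemma OrthonormalBasis.sum_bilin_eq {ι κ W : Type*} [Fintype ι] [Fintype κ]
    [AddCommGroup W] [Module ℝ W] (e : OrthonormalBasis ι ℝ V) (b : OrthonormalBasis κ ℝ V)
    {f : V → V → W} (hf : IsBilinearMap ℝ f) :
    ∑ i, f (e i) (e i) = ∑ k, f (b k) (b k) := by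
  classical
  obtain ⟨B, rfl⟩ : ∃ B : V →ₗ[ℝ] V →ₗ[ℝ] W, f = fun x y => B x y := ⟨hf.toLinearMap, rfl⟩
  have h1 (i : ι) : B (e i) (e i)
      = ∑ k, ∑ l, (inner ℝ (b k) (e i) * inner ℝ (e i) (b l)) • B (b k) (b l) := by
    conv_lhs => rw [← b.sum_repr' (e i)]
    simp only [map_sum, map_smul, LinearMap.sum_apply, LinearMap.smul_apply, Finset.smul_sum,
      smul_smul]
    rw [Finset.sum_comm]
    refine Finset.sum_congr rfl fun k _ => Finset.sum_congr rfl fun l _ => ?_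
    rw [real_inner_comm (b l) (e i), mul_comm]
  simp only [h1]
  rw [Finset.sum_comm]
  refine Finset.sum_congr rfl fun k _ => ?_
  rw [Finset.sum_comm]
  simp only [← Finset.sum_smul, e.sum_inner_mul_inner, b.inner_eq_ite, ite_smul, one_smul,
    zero_smul, Finset.sum_ite_eq, Finset.mem_univ, if_true]

/-- The double trace of a quadrilinear map does not depend on the orthonormal basis. -/
lemma OrthonormalBasis.sum_sum_quadrilin_eq {ι κ W : Type*} [Fintype ι] [Fintype κ]
    [AddCommGroup W] [Module ℝ W] (e : OrthonormalBasis ι ℝ V) (b : OrthonormalBasis κ ℝ V)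
    {f : V → V → V → V → W} (h₁ : ∀ z w, IsBilinearMap ℝ fun x y => f x y z w)
    (h₂ : ∀ x y, IsBilinearMap ℝ (f x y)) :
    ∑ i, ∑ j, f (e i) (e i) (e j) (e j) = ∑ k, ∑ l, f (b k) (b k) (b l) (b l) := by
  simp only [e.sum_bilin_eq b (h₂ _ _)]
  rw [Finset.sum_comm]
  conv_rhs => rw [Finset.sum_comm]
  exact Finset.sum_congr rfl fun l _ => e.sum_bilin_eq b (h₁ (b l) (b l))

/-- An isometric involution is diagonalised by an orthonormal basis, with eigenvalues `±1`. -/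
lemma exists_orthonormalBasis_of_isometric_involutive [FiniteDimensional ℝ V] {P : V →ₗ[ℝ] V}
    (hP : ∀ v, P (P v) = v) (hi : ∀ u v, inner ℝ (P u) (P v) = inner ℝ u v) :
    ∃ (b : OrthonormalBasis (Fin (Module.finrank ℝ V)) ℝ V) (ε : Fin (Module.finrank ℝ V) → ℝ),
      (∀ i, ε i = 1 ∨ ε i = -1) ∧ ∀ i, P (b i) = ε i • b i := by
  have hs : P.IsSymmetric := fun u v => by rw [← hi, hP]
  refine ⟨hs.eigenvectorBasis rfl, hs.eigenvalues rfl, fun i => ?_, fun i => ?_⟩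
  -- On a unit eigenvector the isometry condition says that the square of the eigenvalue is `1`.
  · have h := hi (hs.eigenvectorBasis rfl i) (hs.eigenvectorBasis rfl i)
    rw [hs.apply_eigenvectorBasis, inner_smul_left, inner_smul_right] at h
    simp only [OrthonormalBasis.inner_eq_one, mul_one, conj_trivial, RCLike.ofReal_real_eq_id,
      id_eq] at h
    exact mul_self_eq_one_iff.mp h
  · simp [hs.apply_eigenvectorBasis rfl i]

/-- The algebraic properties at one point of the difference `Q` of the canonical connection and the
Levi-Civita connection of a Riemannian `W₃`-manifold with almost product structure `P`. -/
structure IsCanonicalDifference (P : V →ₗ[ℝ] V) (Q : V →ₗ[ℝ] V →ₗ[ℝ] V) : Prop where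
  involutive : ∀ v, P (P v) = v
  isometric : ∀ u v, inner ℝ (P u) (P v) = inner ℝ u v
  skew : ∀ u v w, inner ℝ (Q u v) w + inner ℝ v (Q u w) = 0
  cyclic : ∀ u v w, inner ℝ (P (Q u v) - Q u (P v)) w + inner ℝ (P (Q v w) - Q v (P w)) u
    + inner ℝ (P (Q w u) - Q w (P u)) v = 0
  torsion : ∀ u v w, inner ℝ (Q u v - Q v u) w + inner ℝ (Q v w - Q w v) u
    + inner ℝ (Q (P u) v - Q v (P u)) (P w) + inner ℝ (Q v (P w) - Q (P w) v) (P u) = 0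

namespace IsCanonicalDifference

variable {P : V →ₗ[ℝ] V} {Q : V →ₗ[ℝ] V →ₗ[ℝ] V} (h : IsCanonicalDifference P Q)
include h

lemma inner_swap (u v w : V) : inner ℝ (Q u w) v = - inner ℝ (Q u v) w := by
  have := h.skew u v w
  rw [real_inner_comm (Q u w) v] at this
  linarith

lemma inner_symm (u v : V) : inner ℝ (P u) v = inner ℝ u (P v) := by
  rw [← h.isometric, h.involutive]

section Eigenvectors

variable {x y z : V} {ε δ κ : ℝ}

/-- As `P` is symmetric, each commutator with `P` contributes the difference of two eigenvalues. -/
lemma cyclic_eigen (hx : P x = ε • x) (hy : P y = δ • y) (hz : P z = κ • z) :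
    (κ - δ) * inner ℝ (Q x y) z + (ε - κ) * inner ℝ (Q y z) x
      + (δ - ε) * inner ℝ (Q z x) y = 0 := by
  have := h.cyclic x y z
  simp only [inner_sub_left, h.inner_symm, hx, hy, hz, map_smul, inner_smul_left,
    inner_smul_right, conj_trivial] at this
  linarith

/-- The two terms with `P` repeat the other two with the factor `ε κ`; skewness then brings all
entries into cyclic order. Only the outer vectors need to be eigenvectors, as `P` is never applied
to `y`. -/
lemma torsion_eigen (hx : P x = ε • x) (hz : P z = κ • z) :
    (1 + ε * κ) * (inner ℝ (Q x y) z + 2 * inner ℝ (Q y z) x + inner ℝ (Q z x) y) = 0 := by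
  have := h.torsion x y z
  simp only [inner_sub_left, hx, hz, map_smul, LinearMap.smul_apply, inner_smul_left,
    inner_smul_right, conj_trivial] at this
  rw [h.inner_swap y z x, h.inner_swap z x y] at this
  linarith

/-- With `a, b, c` the three cyclic entries, equal eigenvalues give three torsion relations such as
`a + 2b + c = 0`, which force `a = b = c = 0`. If one eigenvalue differs, one torsion relation
survives and the cyclic relation equates two of the entries. -/
lemma eigen_relations (hε : ε = 1 ∨ ε = -1) (hδ : δ = 1 ∨ δ = -1) (hκ : κ = 1 ∨ κ = -1)
    (hx : P x = ε • x) (hy : P y = δ • y) (hz : P z = κ • z) :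
    (ε = δ ∧ δ = κ ∧ inner ℝ (Q x y) z = 0 ∧ inner ℝ (Q y z) x = 0 ∧ inner ℝ (Q z x) y = 0) ∨
    (ε = δ ∧ δ = - κ ∧ inner ℝ (Q x y) z = inner ℝ (Q y z) x
      ∧ inner ℝ (Q z x) y = - inner ℝ (Q y z) x) ∨
    (δ = κ ∧ κ = - ε ∧ inner ℝ (Q y z) x = inner ℝ (Q z x) y
      ∧ inner ℝ (Q x y) z = - inner ℝ (Q z x) y) ∨
    (κ = ε ∧ ε = - δ ∧ inner ℝ (Q z x) y = inner ℝ (Q x y) z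
      ∧ inner ℝ (Q y z) x = - inner ℝ (Q x y) z) := by
  have h1 := h.cyclic_eigen hx hy hz
  have h2 := h.torsion_eigen (y := y) hx hz
  have h3 := h.torsion_eigen (y := z) hy hx
  have h4 := h.torsion_eigen (y := x) hz hy
  rcases hε with rfl | rfl <;> rcases hδ with rfl | rfl <;> rcases hκ with rfl | rfl <;>
    norm_num at h1 h2 h3 h4 ⊢ <;> constructorm* _ ∧ _ <;> linarith

/-- If `ε = -δ` the terms cancel. If `ε = δ`, the relations give `g(Q(x, y), z) = g(Q(y, z), x)`,
which by skewness is `-g(Q(y, x), z)`. -/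
lemma inner_symm_part_eigen (hε : ε = 1 ∨ ε = -1) (hδ : δ = 1 ∨ δ = -1) (hκ : κ = 1 ∨ κ = -1)
    (hx : P x = ε • x) (hy : P y = δ • y) (hz : P z = κ • z) :
    inner ℝ (Q x y + Q y x + Q (P x) (P y) + Q (P y) (P x)) z = 0 := by
  have key : (1 + ε * δ) * (inner ℝ (Q x y) z - inner ℝ (Q y z) x) = 0 := by
    rcases h.eigen_relations hε hδ hκ hx hy hz with H | H | H | H <;> grind
  simp only [hx, hy, map_smul, LinearMap.smul_apply, inner_add_left, inner_smul_left, conj_trivial]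
  rw [h.inner_swap y z x]
  linarith

/-- The source of the constant `1/8`: in a mixed triple the entries are `t, t, -t` in some order, so
the products add up to `t²`. Exactly two eigenvalue differences are `±2`, so the squares add up to
`8t²`. -/
lemma cyclic_sum_eigen (hε : ε = 1 ∨ ε = -1) (hδ : δ = 1 ∨ δ = -1) (hκ : κ = 1 ∨ κ = -1)
    (hx : P x = ε • x) (hy : P y = δ • y) (hz : P z = κ • z) :
    (inner ℝ (Q x y) z * inner ℝ (Q y x) z - 1 / 8 * ((κ - δ) * inner ℝ (Q x y) z) ^ 2)
    + (inner ℝ (Q y z) x * inner ℝ (Q z y) x - 1 / 8 * ((ε - κ) * inner ℝ (Q y z) x) ^ 2)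
    + (inner ℝ (Q z x) y * inner ℝ (Q x z) y - 1 / 8 * ((δ - ε) * inner ℝ (Q z x) y) ^ 2) = 0 := by
  rw [h.inner_swap y z x, h.inner_swap z x y, h.inner_swap x y z]
  have hε2 : ε ^ 2 = 1 := by rcases hε with rfl | rfl <;> norm_num
  have hδ2 : δ ^ 2 = 1 := by rcases hδ with rfl | rfl <;> norm_num
  rcases h.eigen_relations hε hδ hκ hx hy hz with
    ⟨rfl, rfl, h1, h2, h3⟩ | ⟨rfl, h0, h1, h2⟩ | ⟨rfl, h0, h1, h2⟩ | ⟨rfl, h0, h1, h2⟩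
  · rw [h1, h2, h3]; ring
  · obtain rfl : κ = - ε := by linarith
    rw [h1, h2]; linear_combination (-(inner ℝ (Q y z) x) ^ 2) * hε2
  · rw [h0, h1, h2]; linear_combination (-(inner ℝ (Q z x) y) ^ 2) * hε2
  · rw [h0, h1, h2]; linear_combination (-(inner ℝ (Q x y) z) ^ 2) * hδ2

end Eigenvectors

variable [FiniteDimensional ℝ V]

/-- The symmetric part of `Q` anticommutes with `P`. -/
lemma symm_part (x y : V) : Q x y + Q y x + Q (P x) (P y) + Q (P y) (P x) = 0 := by
  obtain ⟨b, ε, hε, hb⟩ := exists_orthonormalBasis_of_isometric_involutive h.involutive h.isometric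
  have key : Q + Q.flip + Q.compl₁₂ P P + (Q.compl₁₂ P P).flip = 0 := by
    refine b.toBasis.ext fun i => b.toBasis.ext fun j =>
      InnerProductSpace.ext_inner_right_basis b.toBasis fun k => ?_
    simpa using h.inner_symm_part_eigen (hε i) (hε j) (hε k) (hb i) (hb j) (hb k)
  simpa using congr($key x y)

/-- The sum of `g(Q(eᵢ, eⱼ), Q(eⱼ, eᵢ))` is an eighth of the square norm of `∇P`. -/
lemma sum_inner_swap {ι : Type*} [Fintype ι] (e : OrthonormalBasis ι ℝ V) :
    ∑ i, ∑ j, inner ℝ (Q (e i) (e j)) (Q (e j) (e i)) = 1 / 8 * ∑ i, ∑ j,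
      inner ℝ (P (Q (e i) (e j)) - Q (e i) (P (e j))) (P (Q (e i) (e j)) - Q (e i) (P (e j))) := by
  obtain ⟨b, ε, hε, hb⟩ := exists_orthonormalBasis_of_isometric_involutive h.involutive h.isometric
  -- The arguments are ordered so that the slots to be contracted with each other are adjacent.
  have h1 := e.sum_sum_quadrilin_eq b (f := fun x y z w => inner ℝ (Q x z) (Q w y))
    (fun z w => by constructor <;> intros <;> simp [inner_add_left, inner_add_right,
      inner_smul_left, inner_smul_right])
    (fun z w => by constructor <;> intros <;> simp [inner_add_left, inner_add_right,
      inner_smul_left, inner_smul_right])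
  have h2 := e.sum_sum_quadrilin_eq b
    (f := fun x y z w => inner ℝ (P (Q x z) - Q x (P z)) (P (Q y w) - Q y (P w)))
    (fun z w => by constructor <;> intros <;> simp [inner_add_left, inner_add_right,
      inner_sub_left, inner_sub_right, inner_smul_left, inner_smul_right] <;> ring)
    (fun z w => by constructor <;> intros <;> simp [inner_add_left, inner_add_right,
      inner_sub_left, inner_sub_right, inner_smul_left, inner_smul_right] <;> ring)
  rw [h1, h2]
  have hF (i j k) : inner ℝ (P (Q (b i) (b j)) - Q (b i) (P (b j))) (b k)
      = (ε k - ε j) * inner ℝ (Q (b i) (b j)) (b k) := by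
    rw [inner_sub_left, h.inner_symm, hb, hb, map_smul, inner_smul_left, inner_smul_right]
    simp only [conj_trivial]
    ring
  set f : _ → _ → _ → ℝ := fun i j k => inner ℝ (Q (b i) (b j)) (b k) * inner ℝ (Q (b j) (b i)) (b k)
    - 1 / 8 * ((ε k - ε j) * inner ℝ (Q (b i) (b j)) (b k)) ^ 2 with hf
  have hcyc (i j k) : f i j k + f j k i + f k i j = 0 :=
    h.cyclic_sum_eigen (hε i) (hε j) (hε k) (hb i) (hb j) (hb k)
  -- Relabelling indices cyclically does not change the full sum, so three times this sum is the sum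
  -- of `hcyc` over all triples.
  have hsum : ∑ i, ∑ j, ∑ k, f i j k = 0 := by
    have e1 : ∑ i, ∑ j, ∑ k, f j k i = ∑ i, ∑ j, ∑ k, f i j k := by
      rw [Finset.sum_comm]
      exact Finset.sum_congr rfl fun _ _ => Finset.sum_comm
    have e2 : ∑ i, ∑ j, ∑ k, f k i j = ∑ i, ∑ j, ∑ k, f i j k :=
      (Finset.sum_congr rfl fun _ _ => Finset.sum_comm).trans Finset.sum_comm
    have := Finset.sum_congr rfl fun i (_ : i ∈ Finset.univ) =>
      Finset.sum_congr rfl fun j (_ : j ∈ Finset.univ) =>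
        Finset.sum_congr rfl fun k (_ : k ∈ Finset.univ) => hcyc i j k
    simp only [Finset.sum_add_distrib, Finset.sum_const_zero, e1, e2] at this
    linarith
  rw [← sub_eq_zero, ← hsum, Finset.mul_sum, ← Finset.sum_sub_distrib]
  refine Finset.sum_congr rfl fun i _ => ?_
  rw [Finset.mul_sum, ← Finset.sum_sub_distrib]
  refine Finset.sum_congr rfl fun j _ => ?_
  rw [← b.sum_inner_mul_inner, ← b.sum_inner_mul_inner, Finset.mul_sum, ← Finset.sum_sub_distrib]
  refine Finset.sum_congr rfl fun k _ => ?_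
  rw [real_inner_comm _ (b k), real_inner_comm _ (b k), hF, hf]
  ring

end IsCanonicalDifference

/-- A bilinear map whose symmetric part anticommutes with an isometric involution is trace-free. -/
lemma OrthonormalBasis.sum_eq_zero_of_symm_part [FiniteDimensional ℝ V] {ι W : Type*} [Fintype ι]
    [AddCommGroup W] [Module ℝ W] (e : OrthonormalBasis ι ℝ V) {P : V →ₗ[ℝ] V}
    (hP : ∀ v, P (P v) = v) (hi : ∀ u v, inner ℝ (P u) (P v) = inner ℝ u v)
    {B : V →ₗ[ℝ] V →ₗ[ℝ] W}
    (hB : ∀ x y, B x y + B y x + B (P x) (P y) + B (P y) (P x) = 0) :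
    ∑ i, B (e i) (e i) = 0 := by
  obtain ⟨b, ε, hε, hb⟩ := exists_orthonormalBasis_of_isometric_involutive hP hi
  rw [e.sum_bilin_eq b (f := fun x y => B x y) (by constructor <;> intros <;> simp)]
  refine Finset.sum_eq_zero fun i _ => ?_
  have := hB (b i) (b i)
  -- On an eigenvector all four terms coincide, because `(±1)² = 1`.
  have h4 : (4 : ℝ) • B (b i) (b i) = 0 := by
    rw [← this, hb]
    rcases hε i with h | h <;> rw [h] <;> simp <;> module
  simpa using h4

/-- The trace of the difference of the curvature tensors of the canonical connection and of the
Levi-Civita connection, where `D u` is the covariant derivative of `Q` along `u` with respect to the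
canonical connection. -/
lemma IsCanonicalDifference.sum_curvature_difference [FiniteDimensional ℝ V] {ι : Type*} [Fintype ι]
    {P : V →ₗ[ℝ] V} {Q : V →ₗ[ℝ] V →ₗ[ℝ] V} (h : IsCanonicalDifference P Q)
    (e : OrthonormalBasis ι ℝ V) {D : V → V →ₗ[ℝ] V →ₗ[ℝ] V}
    (hskew : ∀ u v w z, inner ℝ (D u v w) z + inner ℝ w (D u v z) = 0)
    (hD : ∀ u x y, D u x y + D u y x + D u (P x) (P y) + D u (P y) (P x) = 0) :
    ∑ j, ∑ i, inner ℝ (D (e i) (e j) (e j) - D (e j) (e i) (e j)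
      + Q (Q (e i) (e j) - Q (e j) (e i)) (e j)
      - Q (e i) (Q (e j) (e j)) + Q (e j) (Q (e i) (e j))) (e i)
      = ∑ i, ∑ j, inner ℝ (Q (e i) (e j)) (Q (e j) (e i)) := by
  have hswap (u v w) := h.inner_swap u v w
  have hQ0 : ∑ j, Q (e j) (e j) = 0 :=
    e.sum_eq_zero_of_symm_part h.involutive h.isometric h.symm_part
  have hD0 (u) : ∑ j, D u (e j) (e j) = 0 :=
    e.sum_eq_zero_of_symm_part h.involutive h.isometric (hD u)
  have t1 : ∑ j, ∑ i, inner ℝ (D (e i) (e j) (e j)) (e i) = 0 := by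
    rw [Finset.sum_comm]
    simp [← sum_inner, hD0]
  -- Skewness moves the repeated vector into both arguments of `D (e j)`, where the trace vanishes.
  have t2 : ∑ j, ∑ i, inner ℝ (D (e j) (e i) (e j)) (e i) = 0 := by
    have hij (i j) : inner ℝ (D (e j) (e i) (e j)) (e i) = - inner ℝ (D (e j) (e i) (e i)) (e j) := by
      have := hskew (e j) (e i) (e j) (e i)
      rw [real_inner_comm (D _ _ _)] at this
      linarith
    simp [hij, ← sum_inner, hD0]
  have t3 : ∑ j, ∑ i, inner ℝ (Q (e i) (Q (e j) (e j))) (e i) = 0 := by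
    rw [Finset.sum_comm]
    simp [← sum_inner, ← map_sum, hQ0]
  have t4 : ∑ j, ∑ i, inner ℝ (Q (e j) (Q (e i) (e j))) (e i)
      = - ∑ i, ∑ j, inner ℝ (Q (e i) (e j)) (Q (e j) (e i)) := by
    rw [Finset.sum_comm]
    simp only [hswap _ (e _) (Q _ _), Finset.sum_neg_distrib, real_inner_comm]
  -- Expanding the inner `Q` in the basis gives a product of two entries. Two applications of
  -- skewness are needed here and one in `t6`, hence the opposite signs.
  have t5 (i j) : inner ℝ (Q (Q (e i) (e j)) (e j)) (e i)
      = ∑ k, inner ℝ (Q (e i) (e k)) (e j) * inner ℝ (Q (e k) (e i)) (e j) := by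
    conv_lhs => rw [← e.sum_repr' (Q (e i) (e j))]
    simp only [map_sum, map_smul, LinearMap.sum_apply, LinearMap.smul_apply, sum_inner,
      inner_smul_left, conj_trivial]
    refine Finset.sum_congr rfl fun k _ => ?_
    rw [real_inner_comm, hswap (e i) (e k) (e j), hswap (e k) (e i) (e j)]
    ring
  have t6 (i j) : inner ℝ (Q (Q (e j) (e i)) (e j)) (e i)
      = - ∑ k, inner ℝ (Q (e j) (e k)) (e i) * inner ℝ (Q (e k) (e j)) (e i) := by
    conv_lhs => rw [← e.sum_repr' (Q (e j) (e i))]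
    simp only [map_sum, map_smul, LinearMap.sum_apply, LinearMap.smul_apply, sum_inner,
      inner_smul_left, conj_trivial, ← Finset.sum_neg_distrib]
    refine Finset.sum_congr rfl fun k _ => ?_
    rw [real_inner_comm, hswap (e j) (e k) (e i)]
    ring
  have t7 : ∑ i, ∑ j, inner ℝ (Q (e i) (e j)) (Q (e j) (e i))
      = ∑ i, ∑ j, ∑ k, inner ℝ (Q (e i) (e j)) (e k) * inner ℝ (Q (e j) (e i)) (e k) := by
    refine Finset.sum_congr rfl fun i _ => Finset.sum_congr rfl fun j _ => ?_
    rw [← e.sum_inner_mul_inner]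
    exact Finset.sum_congr rfl fun k _ => by rw [real_inner_comm _ (e k)]
  have t8 : ∑ j, ∑ i, inner ℝ (Q (Q (e i) (e j)) (e j)) (e i)
      = ∑ i, ∑ j, inner ℝ (Q (e i) (e j)) (Q (e j) (e i)) := by
    rw [t7, Finset.sum_comm]
    exact Finset.sum_congr rfl fun i _ => by simp only [t5]; exact Finset.sum_comm
  have t9 : ∑ j, ∑ i, inner ℝ (Q (Q (e j) (e i)) (e j)) (e i)
      = - ∑ i, ∑ j, inner ℝ (Q (e i) (e j)) (Q (e j) (e i)) := by
    simp only [t7, t6, Finset.sum_neg_distrib]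
    exact congrArg _ (Finset.sum_congr rfl fun i _ => Finset.sum_comm)
  simp only [inner_add_left, inner_sub_left, map_sub, LinearMap.sub_apply, Finset.sum_add_distrib,
    Finset.sum_sub_distrib]
  rw [t1, t2, t3, t4, t8, t9]
  ring

end LinearAlgebra

section Geometry

/-! ### Tensoriality and regularity of the difference of two connections. -/

open FiberBundle
open scoped Topology

variable {E : Type*} [NormedAddCommGroup E] [NormedSpace ℝ E] [FiniteDimensional ℝ E]
  {H : Type*} [TopologicalSpace H] {I : ModelWithCorners ℝ E H}
  {M : Type*} [TopologicalSpace M] [ChartedSpace H M] [IsManifold I ∞ M]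

/-- A smooth connection maps a vector field that is smooth near `x` to a field of endomorphisms that
is differentiable at `x`. -/
lemma CovariantDerivative.mdifferentiableAt_of_smooth [T2Space M]
    {nab : CovariantDerivative I E (TangentSpace I : M → Type _)}
    (hnab : nab.ContMDiffCovariantDerivative ∞) {σ : Π x : M, TangentSpace I x} {x : M} {s : Set M}
    (hs : s ∈ 𝓝 x) (hσ : ContMDiffOn I I.tangent ∞ (fun p => (⟨p, σ p⟩ : TangentBundle I M)) s) :
    MDifferentiableAt I (I.prod 𝓘(ℝ, E →L[ℝ] E)) (fun p => (⟨p, nab σ p⟩ :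
      TotalSpace (E →L[ℝ] E) (fun p : M => TangentSpace I p →L[ℝ] TangentSpace I p))) x := by
  obtain ⟨u, hus, huo, hxu⟩ := mem_nhds_iff.mp hs
  -- Smoothness of a connection is tested on global fields, so `σ` is cut off by a bump function
  -- equal to `1` near `x`.
  obtain ⟨f, -, hf⟩ := (SmoothBumpFunction.nhds_basis_tsupport (I := I) x).mem_iff.mp
    (huo.mem_nhds hxu)
  have hσ' : ContMDiff I I.tangent ∞ (fun p => (⟨p, (⇑f • σ) p⟩ : TangentBundle I M)) :=
    ContMDiffOn.smul_section_of_tsupport f.contMDiff.contMDiffOn huo hf (hσ.mono hus)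
  have h1 := (hnab.contMDiff.contMDiff (σ := ⇑f • σ) hσ'.contMDiffOn).contMDiffAt Filter.univ_mem
    |>.mdifferentiableAt (x := x) (by simp)
  refine h1.congr_of_eventuallyEq ?_
  -- Equality of germs at every `p` near `x` is needed: the covariant derivative at `p` depends on
  -- the germ there.
  have hfe : ∀ᶠ p in 𝓝 x, ∀ᶠ q in 𝓝 p, σ q = (⇑f • σ) q := by
    refine Filter.Eventually.eventually_nhds (f.eventuallyEq_one.mono fun q hq => ?_)
    simp [hq]
  filter_upwards [hfe, huo.mem_nhds hxu] with p hp hpu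
  congr 1
  refine nab.isCovariantDerivativeOnUniv.congr_of_eventuallyEq
    ?_ (hσ'.mdifferentiable (by simp) p) Filter.univ_mem hp
  exact ((hσ.mono hus).contMDiffAt (huo.mem_nhds hpu)).mdifferentiableAt (by simp)

/-- The operator `V ↦ (∇P) V = ∇ (P V) - P (∇ V)` is tensorial. -/
lemma CovariantDerivative.tensorialAt_covDerivEnd
    (nab : CovariantDerivative I E (TangentSpace I : M → Type _))
    {P : Π x : M, TangentSpace I x →L[ℝ] TangentSpace I x} {x : M}
    (hP : MDifferentiableAt I (I.prod 𝓘(ℝ, E →L[ℝ] E)) (fun p => (⟨p, P p⟩ :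
      TotalSpace (E →L[ℝ] E) (fun p : M => TangentSpace I p →L[ℝ] TangentSpace I p))) x)
    (u : TangentSpace I x) :
    TensorialAt I E (fun V : Π p : M, TangentSpace I p =>
      nab (fun p => P p (V p)) x u - P x (nab V x u)) x where
  smul {f σ} hf hσ := by
    have h : (fun p => P p ((f • σ) p)) = f • fun p => P p (σ p) := by
      ext p; simp
    rw [h, nab.isCovariantDerivativeOnUniv.leibniz (hP.clm_bundle_apply hσ) hf,
      nab.isCovariantDerivativeOnUniv.leibniz hσ hf]
    simp [smul_sub]
  add {σ σ'} hσ hσ' := by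
    have h : (fun p => P p ((σ + σ') p)) = (fun p => P p (σ p)) + fun p => P p (σ' p) := by
      ext p; simp
    rw [h, nab.isCovariantDerivativeOnUniv.add (hP.clm_bundle_apply hσ) (hP.clm_bundle_apply hσ'),
      nab.isCovariantDerivativeOnUniv.add hσ hσ']
    simp only [add_apply, map_add]
    abel

namespace RiemannianAlmostProduct

/-- Tensoriality allows any differentiable field in place of the chosen extension. -/
lemma covDerivEnd_apply (nab : CovariantDerivative I E (TangentSpace I : M → Type _))
    {P : Π x : M, TangentSpace I x →L[ℝ] TangentSpace I x} {x : M}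
    (hP : MDifferentiableAt I (I.prod 𝓘(ℝ, E →L[ℝ] E)) (fun p => (⟨p, P p⟩ :
      TotalSpace (E →L[ℝ] E) (fun p : M => TangentSpace I p →L[ℝ] TangentSpace I p))) x)
    (u : TangentSpace I x) {V : Π p : M, TangentSpace I p}
    (hV : MDifferentiableAt I I.tangent (fun p => (⟨p, V p⟩ : TangentBundle I M)) x) :
    covDerivEnd nab P x u (V x) = nab (fun p => P p (V p)) x u - P x (nab V x u) := by
  have h := (nab.tensorialAt_covDerivEnd hP u).pointwise
    (mdifferentiableAt_extend I E (V x)) hV (by simp)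
  exact h

/-- The difference `Q(u, v) = ∇'_u v - ∇_u v` of two linear connections. -/
noncomputable def differenceTensor (nab nab' : CovariantDerivative I E (TangentSpace I : M → Type _)) (x : M) :
    TangentSpace I x →ₗ[ℝ] TangentSpace I x →ₗ[ℝ] TangentSpace I x :=
  LinearMap.mk₂ ℝ (fun u v => nab'.difference nab x v u) (by simp) (by simp) (by simp)
    (by simp)

variable {nab nab' : CovariantDerivative I E (TangentSpace I : M → Type _)} {x : M}

lemma differenceTensor_apply {V : Π p : M, TangentSpace I p}
    (hV : MDifferentiableAt I I.tangent (fun p => (⟨p, V p⟩ : TangentBundle I M)) x)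
    (u : TangentSpace I x) :
    differenceTensor nab nab' x u (V x) = nab' V x u - nab V x u := by
  have := IsCovariantDerivativeOn.difference_apply nab'.isCovariantDerivativeOnUniv
    nab.isCovariantDerivativeOnUniv (x := x) trivial hV
  exact congr($this u)

lemma differenceTensor_eq_extend (u v : TangentSpace I x) :
    differenceTensor nab nab' x u v = nab' (extend E v) x u - nab (extend E v) x u := by
  have := differenceTensor_apply (nab := nab) (nab' := nab') (mdifferentiableAt_extend I E v) u
  rwa [extend_apply_self] at this

/-- The difference tensor of two smooth connections maps differentiable fields to differentiable
fields. -/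
lemma mdifferentiableAt_differenceTensor [T2Space M]
    (hnab : IsSmoothConnection nab) (hnab' : IsSmoothConnection nab')
    {V W : Π p : M, TangentSpace I p}
    (hV : MDifferentiableAt I I.tangent (fun p => (⟨p, V p⟩ : TangentBundle I M)) x)
    (hW : MDifferentiableAt I I.tangent (fun p => (⟨p, W p⟩ : TangentBundle I M)) x) :
    MDifferentiableAt I I.tangent
      (fun p => (⟨p, differenceTensor nab nab' p (V p) (W p)⟩ : TangentBundle I M)) x := by
  let t := trivializationAt E (TangentSpace I : M → Type _) x
  have hx : x ∈ t.baseSet := mem_baseSet_trivializationAt E (TangentSpace I : M → Type _) x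
  let b := Module.Basis.ofVectorSpace ℝ E
  let s := t.localFrame b
  let c := t.localFrameCoeff I b
  have hs (i) : ContMDiffOn I I.tangent ∞ (fun p => (⟨p, s i p⟩ : TangentBundle I M)) t.baseSet :=
    t.contMDiffOn_localFrame_baseSet ∞ b i
  have hs1 (i) {p} (hp : p ∈ t.baseSet) :
      MDifferentiableAt I I.tangent (fun p => (⟨p, s i p⟩ : TangentBundle I M)) p :=
    ((hs i).contMDiffAt (t.open_baseSet.mem_nhds hp)).mdifferentiableAt (by simp)
  -- `W` is only differentiable, so regularity of a smooth connection does not apply to it directly.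
  -- By linearity it is expanded in a smooth local frame, and the connections act on frame fields
  -- only.
  have hsum : MDifferentiableAt I I.tangent (fun p => (⟨p, ∑ i, (LinearMap.piApply (c i) W •
      fun p => nab' (s i) p (V p) - nab (s i) p (V p)) p⟩ : TangentBundle I M)) x := by
    refine .sum_section fun i _ => ?_
    refine .smul_section (mdifferentiableAt_localFrameCoeff b hx hW i) ?_
    have ht := t.open_baseSet.mem_nhds hx
    exact mdifferentiableAt_sub_section
      ((nab'.mdifferentiableAt_of_smooth hnab' ht (hs i)).clm_bundle_apply hV)
      ((nab.mdifferentiableAt_of_smooth hnab ht (hs i)).clm_bundle_apply hV)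
  refine hsum.congr_of_eventuallyEq ?_
  filter_upwards [t.open_baseSet.mem_nhds hx] with p hp
  congr 1
  conv_lhs => rw [t.eq_sum_localFrameCoeff_smul (I := I) (b := b) (s := W) hp]
  rw [map_sum]
  refine Finset.sum_congr rfl fun i _ => ?_
  rw [map_smul, differenceTensor_apply (hs1 i hp)]
  rfl

end RiemannianAlmostProduct

end Geometry

section Curvature

/-! ### The derivative of the difference tensor and the comparison of curvatures. -/

open FiberBundle
open scoped Topology

namespace RiemannianAlmostProduct

variable {E : Type*} [NormedAddCommGroup E] [NormedSpace ℝ E] [FiniteDimensional ℝ E]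
  {H : Type*} [TopologicalSpace H] {I : ModelWithCorners ℝ E H}
  {M : Type*} [TopologicalSpace M] [T2Space M] [ChartedSpace H M] [IsManifold I ∞ M]
  {nab nab' : CovariantDerivative I E (TangentSpace I : M → Type _)} {x : M}

/-- The covariant derivative `(∇'_u Q)(V, W)` of the difference tensor `Q = ∇' - ∇`, on vector
fields. -/
noncomputable def derivDifferenceField
    (nab nab' : CovariantDerivative I E (TangentSpace I : M → Type _))
    (x : M) (u : TangentSpace I x) (V W : Π p : M, TangentSpace I p) : TangentSpace I x :=
  nab' (fun p => differenceTensor nab nab' p (V p) (W p)) x u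
    - differenceTensor nab nab' x (nab' V x u) (W x)
    - differenceTensor nab nab' x (V x) (nab' W x u)

lemma tensorialAt_derivDifferenceField_left
    (hnab : IsSmoothConnection nab) (hnab' : IsSmoothConnection nab') (u : TangentSpace I x)
    {W : Π p : M, TangentSpace I p}
    (hW : MDifferentiableAt I I.tangent (fun p => (⟨p, W p⟩ : TangentBundle I M)) x) :
    TensorialAt I E (derivDifferenceField nab nab' x u · W) x where
  smul {f σ} hf hσ := by
    have h : (fun p => differenceTensor nab nab' p ((f • σ) p) (W p))
        = f • fun p => differenceTensor nab nab' p (σ p) (W p) := by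
      ext p; simp
    simp only [derivDifferenceField]
    rw [h, nab'.isCovariantDerivativeOnUniv.leibniz
      (mdifferentiableAt_differenceTensor hnab hnab' hσ hW) hf,
      nab'.isCovariantDerivativeOnUniv.leibniz hσ hf]
    simp
    module
  add {σ σ'} hσ hσ' := by
    have h : (fun p => differenceTensor nab nab' p ((σ + σ') p) (W p))
        = (fun p => differenceTensor nab nab' p (σ p) (W p))
          + fun p => differenceTensor nab nab' p (σ' p) (W p) := by
      ext p; simp
    simp only [derivDifferenceField]
    rw [h, nab'.isCovariantDerivativeOnUniv.add
      (mdifferentiableAt_differenceTensor hnab hnab' hσ hW)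
      (mdifferentiableAt_differenceTensor hnab hnab' hσ' hW),
      nab'.isCovariantDerivativeOnUniv.add hσ hσ']
    simp
    module

lemma tensorialAt_derivDifferenceField_right
    (hnab : IsSmoothConnection nab) (hnab' : IsSmoothConnection nab') (u : TangentSpace I x)
    {V : Π p : M, TangentSpace I p}
    (hV : MDifferentiableAt I I.tangent (fun p => (⟨p, V p⟩ : TangentBundle I M)) x) :
    TensorialAt I E (derivDifferenceField nab nab' x u V) x where
  smul {f σ} hf hσ := by
    have h : (fun p => differenceTensor nab nab' p (V p) ((f • σ) p))
        = f • fun p => differenceTensor nab nab' p (V p) (σ p) := by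
      ext p; simp
    simp only [derivDifferenceField]
    rw [h, nab'.isCovariantDerivativeOnUniv.leibniz
      (mdifferentiableAt_differenceTensor hnab hnab' hV hσ) hf,
      nab'.isCovariantDerivativeOnUniv.leibniz hσ hf]
    simp
    module
  add {σ σ'} hσ hσ' := by
    have h : (fun p => differenceTensor nab nab' p (V p) ((σ + σ') p))
        = (fun p => differenceTensor nab nab' p (V p) (σ p))
          + fun p => differenceTensor nab nab' p (V p) (σ' p) := by
      ext p; simp
    simp only [derivDifferenceField]
    rw [h, nab'.isCovariantDerivativeOnUniv.add
      (mdifferentiableAt_differenceTensor hnab hnab' hV hσ)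
      (mdifferentiableAt_differenceTensor hnab hnab' hV hσ'),
      nab'.isCovariantDerivativeOnUniv.add hσ hσ']
    simp
    module

/-- The covariant derivative `∇'_u Q` of the difference tensor `Q = ∇' - ∇`. -/
noncomputable def derivDifference
    (hnab : IsSmoothConnection nab) (hnab' : IsSmoothConnection nab') (u : TangentSpace I x) :
    TangentSpace I x →ₗ[ℝ] TangentSpace I x →ₗ[ℝ] TangentSpace I x :=
  let B := TensorialAt.mkHom₂ (derivDifferenceField nab nab' x u) x
    (fun _ hW => tensorialAt_derivDifferenceField_left hnab hnab' u hW)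
    (fun _ hV => tensorialAt_derivDifferenceField_right hnab hnab' u hV)
  LinearMap.mk₂ ℝ (fun v w => B v w) (by simp) (by simp) (by simp) (by simp)

lemma derivDifference_apply
    (hnab : IsSmoothConnection nab) (hnab' : IsSmoothConnection nab') (u : TangentSpace I x)
    {V W : Π p : M, TangentSpace I p}
    (hV : MDifferentiableAt I I.tangent (fun p => (⟨p, V p⟩ : TangentBundle I M)) x)
    (hW : MDifferentiableAt I I.tangent (fun p => (⟨p, W p⟩ : TangentBundle I M)) x) :
    derivDifference hnab hnab' u (V x) (W x) = derivDifferenceField nab nab' x u V W :=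
  TensorialAt.mkHom₂_apply (Φ := derivDifferenceField nab nab' x u)
    (fun _ hW => tensorialAt_derivDifferenceField_left hnab hnab' u hW)
    (fun _ hV => tensorialAt_derivDifferenceField_right hnab hnab' u hV) hV hW

/-- The curvature tensors of a torsion-free connection `∇` and of a connection `∇' = ∇ + Q`. -/
lemma curvature_eq_add (hnab : IsSmoothConnection nab) (hnab' : IsSmoothConnection nab')
    (htor : nab.torsion = 0) (u v w : TangentSpace I x) :
    curvature nab' x u v w = curvature nab x u v w
      + (derivDifference hnab hnab' u v w - derivDifference hnab hnab' v u w
        + differenceTensor nab nab' x (differenceTensor nab nab' x u v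
            - differenceTensor nab nab' x v u) w
        - differenceTensor nab nab' x u (differenceTensor nab nab' x v w)
        + differenceTensor nab nab' x v (differenceTensor nab nab' x u w)) := by
  have hext (v : TangentSpace I x) := mdifferentiableAt_extend I E v
  obtain ⟨s, hs, hsw⟩ := exists_contMDiffOn_extend (k := ∞) I E w
  obtain ⟨t, hts, hto, hxt⟩ := mem_nhds_iff.mp hs
  have hcov (u : TangentSpace I x) : MDifferentiableAt I I.tangent
      (fun p => (⟨p, nab (extend E w) p (extend E u p)⟩ : TangentBundle I M)) x :=
    (nab.mdifferentiableAt_of_smooth hnab hs hsw).clm_bundle_apply (hext u)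
  have hcov' (u : TangentSpace I x) : MDifferentiableAt I I.tangent
      (fun p => (⟨p, nab' (extend E w) p (extend E u p)⟩ : TangentBundle I M)) x :=
    (nab'.mdifferentiableAt_of_smooth hnab' hs hsw).clm_bundle_apply (hext u)
  have hQ (u) := mdifferentiableAt_differenceTensor hnab hnab' (hext u) (hext w)
  -- Expansion of `∇'_u (∇_v w + Q(v, w))` by `∇' = ∇ + Q` and the product rule for `∇'Q`.
  have key (u v : TangentSpace I x) :
      nab' (fun p => nab' (extend E w) p (extend E v p)) x u
        = nab (fun p => nab (extend E w) p (extend E v p)) x u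
          + differenceTensor nab nab' x u (nab (extend E w) x v)
          + derivDifference hnab hnab' u v w
          + differenceTensor nab nab' x (nab' (extend E v) x u) w
          + differenceTensor nab nab' x v (nab' (extend E w) x u) := by
    have h1 : nab' (fun p => nab' (extend E w) p (extend E v p)) x
        = nab' ((fun p => nab (extend E w) p (extend E v p))
          + fun p => differenceTensor nab nab' p (extend E v p) (extend E w p)) x := by
      refine nab'.isCovariantDerivativeOnUniv.congr_of_eventuallyEq (hcov' v)
        (mdifferentiableAt_add_section (hcov v) (hQ v)) Filter.univ_mem ?_
      filter_upwards [hto.mem_nhds hxt] with p hp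
      have hwp := ((hsw.mono hts).contMDiffAt (hto.mem_nhds hp)).mdifferentiableAt (by simp)
      simp [differenceTensor_apply hwp]
    have h2 := differenceTensor_apply (nab := nab) (nab' := nab') (hcov v) u
    have h3 := derivDifference_apply hnab hnab' u (hext v) (hext w)
    simp only [extend_apply_self, derivDifferenceField] at h2 h3
    rw [h1, nab'.isCovariantDerivativeOnUniv.add (hcov v) (hQ v), h2, h3]
    simp only [add_apply]
    abel
  -- The bracket becomes `∇_u v - ∇_v u`. Subtracted from the `∇'` terms of `key`, it leaves `Q(Q(u,
  -- v) - Q(v, u), w)`.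
  have hbr := CovariantDerivative.torsion_eq_zero_iff nab |>.mp htor (hext u) (hext v)
  simp only [extend_apply_self] at hbr
  simp only [curvature, curvatureField, extend_apply_self]
  have hbw := differenceTensor_apply (nab := nab) (nab' := nab') (hext w)
    (VectorField.mlieBracket I (extend E u) (extend E v) x)
  rw [extend_apply_self] at hbw
  rw [key, key, eq_add_of_sub_eq hbw.symm, ← hbr, differenceTensor_eq_extend v w,
    differenceTensor_eq_extend u w, differenceTensor_eq_extend u v, differenceTensor_eq_extend v u]
  simp only [map_sub, LinearMap.sub_apply]
  abel

end RiemannianAlmostProduct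

end Curvature

section Canonical

/-! ### Identities for the canonical connection. -/

open FiberBundle
open scoped Topology

namespace RiemannianAlmostProduct

variable {E : Type*} [NormedAddCommGroup E] [NormedSpace ℝ E] [FiniteDimensional ℝ E]
  {H : Type*} [TopologicalSpace H] {I : ModelWithCorners ℝ E H}
  {M : Type*} [TopologicalSpace M] [ChartedSpace H M] [IsManifold I ∞ M]
  [RiemannianBundle (fun x : M => TangentSpace I x)]
  {nab nab' : CovariantDerivative I E (TangentSpace I : M → Type _)}
  {S : AlmostProductStructure I M} {x : M}

lemma AlmostProductStructure.mdifferentiableAt (S : AlmostProductStructure I M) (x : M) :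
    MDifferentiableAt I (I.prod 𝓘(ℝ, E →L[ℝ] E)) (fun p => (⟨p, S.P p⟩ :
      TotalSpace (E →L[ℝ] E) (fun p : M => TangentSpace I p →L[ℝ] TangentSpace I p))) x :=
  S.smooth.mdifferentiable (by simp) x

lemma IsNatural.apply_comp (h : IsNatural nab' S) {V : Π p : M, TangentSpace I p}
    (hV : MDifferentiableAt I I.tangent (fun p => (⟨p, V p⟩ : TangentBundle I M)) x)
    (u : TangentSpace I x) :
    nab' (fun p => S.P p (V p)) x u = S.P x (nab' V x u) := by
  rw [← sub_eq_zero, ← covDerivEnd_apply nab' (S.mdifferentiableAt x) u hV, h.parallel]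

lemma inner_differenceTensor_add (hnab : IsMetric nab) (hnab' : IsMetric nab')
    (u v w : TangentSpace I x) :
    inner ℝ (differenceTensor nab nab' x u v) w + inner ℝ v (differenceTensor nab nab' x u w)
      = 0 := by
  have hext (v : TangentSpace I x) := mdifferentiableAt_extend I E v
  have h1 := hnab _ _ x u (hext v) (hext w)
  have h2 := hnab' _ _ x u (hext v) (hext w)
  rw [h1, extend_apply_self, extend_apply_self] at h2
  rw [differenceTensor_eq_extend, differenceTensor_eq_extend, inner_sub_left, inner_sub_right]
  linarith

/-- Substitute `∇ = ∇' - Q`; the `∇'` part drops out since `∇'P = 0`. -/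
lemma covDerivEnd_eq_differenceTensor (h : IsNatural nab' S) (u v : TangentSpace I x) :
    covDerivEnd nab S.P x u v
      = S.P x (differenceTensor nab nab' x u v) - differenceTensor nab nab' x u (S.P x v) := by
  have hv := mdifferentiableAt_extend I E v
  have h1 := differenceTensor_apply (nab := nab) (nab' := nab')
    ((S.mdifferentiableAt x).clm_bundle_apply hv) u
  rw [extend_apply_self, h.apply_comp hv] at h1
  rw [h1, differenceTensor_eq_extend, map_sub, covDerivEnd]
  abel

lemma torsion_eq_differenceTensor (htor : nab.torsion = 0) (u v : TangentSpace I x) :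
    nab'.torsion x u v = differenceTensor nab nab' x u v - differenceTensor nab nab' x v u := by
  have h1 := nab'.torsion_apply_eq_extend u v
  have h2 := nab.torsion_apply_eq_extend u v
  rw [htor] at h2
  simp only [extend_apply_self, Pi.zero_apply, zero_apply] at h1 h2
  rw [h1, differenceTensor_eq_extend, differenceTensor_eq_extend, ← sub_eq_zero]
  refine Eq.trans ?_ h2.symm
  abel

lemma IsCanonical.isCanonicalDifference (hnab : IsLeviCivita nab) (hW3 : IsW3 nab S)
    (hnab' : IsCanonical nab' S) (x : M) :
    IsCanonicalDifference (V := TangentSpace I x) (S.P x : TangentSpace I x →ₗ[ℝ] TangentSpace I x)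
      (differenceTensor nab nab' x) where
  involutive := S.involutive x
  isometric := S.isometric x
  skew := inner_differenceTensor_add hnab.metric hnab'.metric
  cyclic u v w := by
    have := hW3 x u v w
    simp only [tensorF, covDerivEnd_eq_differenceTensor hnab'.toIsNatural] at this
    exact this
  torsion u v w := by
    have := hnab'.torsion_eq x u v w
    simp only [torsion03, torsion_eq_differenceTensor hnab.torsion_eq_zero] at this
    exact this

variable [T2Space M]

/-- The skewness of `Q` is differentiated along `u`. Since `∇'g = 0`, the correction terms are again
instances of that skewness. -/
lemma inner_derivDifference_add [IsContMDiffRiemannianBundle I 1 E (fun x : M => TangentSpace I x)]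
    (hnab : IsSmoothConnection nab) (hnab' : IsSmoothConnection nab')
    (hm : IsMetric nab) (hm' : IsMetric nab') (u v w z : TangentSpace I x) :
    inner ℝ (derivDifference hnab hnab' u v w) z + inner ℝ w (derivDifference hnab hnab' u v z)
      = 0 := by
  have hext (v : TangentSpace I x) := mdifferentiableAt_extend I E v
  have hQ (v w : TangentSpace I x) :=
    mdifferentiableAt_differenceTensor hnab hnab' (hext v) (hext w)
  have hw := derivDifference_apply hnab hnab' u (hext v) (hext w)
  have hz := derivDifference_apply hnab hnab' u (hext v) (hext z)
  simp only [extend_apply_self, derivDifferenceField] at hw hz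
  have h1 := hm' _ _ x u (hQ v w) (hext z)
  have h2 := hm' _ _ x u (hext w) (hQ v z)
  have h3 : (fun p => inner ℝ (extend E w p)
      (differenceTensor nab nab' p (extend E v p) (extend E z p)))
      = - fun p => inner ℝ (differenceTensor nab nab' p (extend E v p) (extend E w p))
        (extend E z p) := by
    ext p
    rw [Pi.neg_apply, eq_neg_iff_add_eq_zero, add_comm]
    exact inner_differenceTensor_add hm hm' _ _ _
  rw [h3, mvfderiv_neg, neg_apply, h1] at h2
  simp only [extend_apply_self] at h2
  have hs (u v w) := inner_differenceTensor_add (x := x) hm hm' u v w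
  have e1 := hs v (nab' (extend E w) x u) z
  have e2 := hs v w (nab' (extend E z) x u)
  have e3 := hs (nab' (extend E v) x u) w z
  rw [hw, hz]
  simp only [inner_sub_left, inner_sub_right]
  linarith

/-- The identity `symm_part` is differentiated by `∇'`, which commutes with `P`. -/
lemma derivDifference_symm_part (hnab : IsLeviCivita nab) (hW3 : IsW3 nab S)
    (hnab' : IsCanonical nab' S) (u v w : TangentSpace I x) :
    derivDifference hnab.smooth hnab'.smooth u v w + derivDifference hnab.smooth hnab'.smooth u w v
      + derivDifference hnab.smooth hnab'.smooth u (S.P x v) (S.P x w)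
      + derivDifference hnab.smooth hnab'.smooth u (S.P x w) (S.P x v) = 0 := by
  have hext (v : TangentSpace I x) := mdifferentiableAt_extend I E v
  have hP (v : TangentSpace I x) := (S.mdifferentiableAt x).clm_bundle_apply (hext v)
  have hQ {V W : Π p : M, TangentSpace I p}
    (hV : MDifferentiableAt I I.tangent (fun p => (⟨p, V p⟩ : TangentBundle I M)) x)
    (hW : MDifferentiableAt I I.tangent (fun p => (⟨p, W p⟩ : TangentBundle I M)) x) :=
    mdifferentiableAt_differenceTensor hnab.smooth hnab'.smooth hV hW
  have e1 := derivDifference_apply hnab.smooth hnab'.smooth u (hext v) (hext w)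
  have e2 := derivDifference_apply hnab.smooth hnab'.smooth u (hext w) (hext v)
  have e3 := derivDifference_apply hnab.smooth hnab'.smooth u (hP v) (hP w)
  have e4 := derivDifference_apply hnab.smooth hnab'.smooth u (hP w) (hP v)
  simp only [extend_apply_self, derivDifferenceField, hnab'.apply_comp (hext _)] at e1 e2 e3 e4
  have hfin (p : M) : FiniteDimensional ℝ (TangentSpace I p) :=
    inferInstanceAs (FiniteDimensional ℝ E)
  have hsymm (p : M) (v w : TangentSpace I p) :=
    (hnab'.isCanonicalDifference hnab hW3 p).symm_part v w
  simp only [ContinuousLinearMap.coe_coe] at hsymm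
  have h0 : (fun p => differenceTensor nab nab' p (extend E v p) (extend E w p))
      + (fun p => differenceTensor nab nab' p (extend E w p) (extend E v p))
      + (fun p => differenceTensor nab nab' p (S.P p (extend E v p)) (S.P p (extend E w p)))
      + (fun p => differenceTensor nab nab' p (S.P p (extend E w p)) (S.P p (extend E v p)))
      = 0 := by
    ext p
    exact hsymm p _ _
  have h1 : nab' _ x u = nab' _ x u := congr(nab' $h0 x u)
  have hvw := hQ (hext v) (hext w)
  have hwv := hQ (hext w) (hext v)
  have hPvw := hQ (hP v) (hP w)
  have hPwv := hQ (hP w) (hP v)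
  have hadd {σ σ' : Π p : M, TangentSpace I p} := nab'.isCovariantDerivativeOnUniv.add
    (σ := σ) (σ' := σ') (x := x)
  rw [hadd (mdifferentiableAt_add_section (mdifferentiableAt_add_section hvw hwv) hPvw) hPwv,
    hadd (mdifferentiableAt_add_section hvw hwv) hPvw, hadd hvw hwv, nab'.zero] at h1
  simp only [add_apply, Pi.zero_apply, zero_apply] at h1
  have s1 := hsymm x (nab' (extend E v) x u) w
  have s2 := hsymm x v (nab' (extend E w) x u)
  rw [e1, e2, e3, e4]
  -- The correction terms in `∇'_u Q` assemble into the same identity at `(∇'_u v, w)` and at `(v,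
  -- ∇'_u w)`.
  have key := congr($h1 - $s1 - $s2)
  rw [sub_zero, sub_zero] at key
  rw [← key]
  abel

end RiemannianAlmostProduct

end Canonical

/-! ### Conclusion: tracing the curvature comparison. -/

theorem theorem4p3
    {E : Type*} [NormedAddCommGroup E] [NormedSpace ℝ E] [FiniteDimensional ℝ E]
    {M : Type*} [TopologicalSpace M] [T2Space M] [ChartedSpace E M] [IsManifold 𝓘(ℝ, E) ∞ M]
    [RiemannianBundle (fun x : M => TangentSpace 𝓘(ℝ, E) x)]
    [IsContMDiffRiemannianBundle 𝓘(ℝ, E) ∞ E (fun x : M => TangentSpace 𝓘(ℝ, E) x)]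
    (S : RiemannianAlmostProduct.AlmostProductStructure 𝓘(ℝ, E) M)
    (nab nab' : CovariantDerivative 𝓘(ℝ, E) E (TangentSpace 𝓘(ℝ, E) : M → Type _))
    (hnab : RiemannianAlmostProduct.IsLeviCivita nab)
    (hW3 : RiemannianAlmostProduct.IsW3 nab S)
    (hnab' : RiemannianAlmostProduct.IsCanonical nab' S) (x : M) :
    RiemannianAlmostProduct.scalarCurvature nab' x
      = RiemannianAlmostProduct.scalarCurvature nab x
        + 1 / 8 * RiemannianAlmostProduct.normSqNablaP nab S x := by
  have : FiniteDimensional ℝ (TangentSpace 𝓘(ℝ, E) x) := inferInstanceAs (FiniteDimensional ℝ E)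
  let e := stdOrthonormalBasis ℝ (TangentSpace 𝓘(ℝ, E) x)
  have hcd := hnab'.isCanonicalDifference hnab hW3 x
  have htrace := hcd.sum_curvature_difference e
    (D := RiemannianAlmostProduct.derivDifference hnab.smooth hnab'.smooth)
    (RiemannianAlmostProduct.inner_derivDifference_add hnab.smooth hnab'.smooth hnab.metric
      hnab'.metric)
    (RiemannianAlmostProduct.derivDifference_symm_part hnab hW3 hnab')
  rw [hcd.sum_inner_swap e] at htrace
  simp only [RiemannianAlmostProduct.scalarCurvature, RiemannianAlmostProduct.ricci,
    RiemannianAlmostProduct.normSqNablaP,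
    RiemannianAlmostProduct.covDerivEnd_eq_differenceTensor hnab'.toIsNatural,
    RiemannianAlmostProduct.curvature_eq_add hnab.smooth hnab'.smooth hnab.torsion_eq_zero,
    inner_add_left (𝕜 := ℝ) (RiemannianAlmostProduct.curvature nab x _ _ _),
    Finset.sum_add_distrib]
  exact congrArg _ htrace
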